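/- Terminology. All compact spaces are Hausdorff. A compact space is zero-dimensional if its clopen subsets form a base of its topology. A compact line is a linearly ordered set which is compact in its order topology. A pseudoclopen of a compact space $K$ is a pair $a=(a^-,a^+)$ with $a^-\subseteq K$ closed, $a^+\subseteq K$ open and $a^-\subseteq a^+$. A map $\phi$ from a family $\mathcal G$ of subsets of a space $L$ to the pseudoclopens of $K$ is an isomorphism (onto its range) if for all $n,m\ge 0$ and all distinct $a_1,\dots,a_n,b_1,\dots,b_m\in\mathcal G$ $$\bigcap_{i\le n}a_i\setminus\bigcup_{j\le m}b_j=\emptyset\ \Longrightarrow\ \bigcap_{i\le n}\phi(a_i)^+\setminus\bigcup_{j\le m}\phi(b_j)^-=\emptyset,$$ $$\bigcap_{i\le n}\phi(a_i)^-\setminus\bigcup_{j\le m}\phi(b_j)^+=\emptyset\ \Longrightarrow\ \bigcap_{i\le n}a_i\setminus\bigcup_{j\le m}b_j=\emptyset,$$ where an empty intersection is the whole space ($L$ or $K$, respectively). A zero-dimensional compact space $L$ is a Boolean image of a compact space $K$ if there is a family $\mathcal G$ of clopen subsets of $L$ that separates the points of $L$ (for all $x\ne y$ in $L$ some $a\in\mathcal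 G$ contains exactly one of $x,y$) and an isomorphism from $\mathcal G$ to a family of pseudoclopens of $K$. Statement. Let $L$ be a nonempty zero-dimensional compact space which is a continuous image of a zero-dimensional compact line $L^*$. Then $L$ is a Boolean image of a compact connected space. -/

import Mathlib

universe u v

/-- A topological space is zero-dimensional if its clopen subsets form a base of its topology. -/
def ZeroDimensional (X : Type*) [TopologicalSpace X] : Prop :=
  TopologicalSpace.IsTopologicalBasis {s : Set X | IsClopen s}

/-- A pseudoclopen `(a⁻, a⁺)` of `K`: a closed set `a⁻` contained in an open set `a⁺`. -/
structure Pseudoclopen (K : Type*) [TopologicalSpace K] where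
  /-- the closed set `a⁻` -/
  inner : Set K
  /-- the open set `a⁺` -/
  outer : Set K
  isClosed_inner : IsClosed inner
  isOpen_outer : IsOpen outer
  inner_subset_outer : inner ⊆ outer

/-- A function `φ` from a family `𝒢` of subsets of `L` into the pseudoclopens of `K` is an
isomorphism (onto its range) if, for all distinct `a₁, …, aₙ, b₁, …, bₘ` in `𝒢`
(that is, for all disjoint finite `A, B ⊆ 𝒢`),
* `⋂ aᵢ \ ⋃ bⱼ = ∅` implies `⋂ φ(aᵢ)⁺ \ ⋃ φ(bⱼ)⁻ = ∅`, and
* `⋂ φ(aᵢ)⁻ \ ⋃ φ(bⱼ)⁺ = ∅` implies `⋂ aᵢ \ ⋃ bⱼ = ∅`.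
An empty intersection is the whole space. Such a `φ` is automatically injective. -/
def IsPseudoclopenIso {L K : Type*} [TopologicalSpace K] (𝒢 : Set (Set L))
    (φ : 𝒢 → Pseudoclopen K) : Prop :=
  ∀ A B : Finset 𝒢, Disjoint A B →
    (((⋂ a ∈ A, (a : Set L)) \ (⋃ b ∈ B, (b : Set L)) = ∅ →
      (⋂ a ∈ A, (φ a).outer) \ (⋃ b ∈ B, (φ b).inner) = ∅) ∧
    ((⋂ a ∈ A, (φ a).inner) \ (⋃ b ∈ B, (φ b).outer) = ∅ →
      (⋂ a ∈ A, (a : Set L)) \ (⋃ b ∈ B, (b : Set L)) = ∅))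

/-- A family of subsets separates points: any two different points are distinguished by
a member containing exactly one of them. -/
def SeparatesPointsOf {L : Type*} (𝒢 : Set (Set L)) : Prop :=
  ∀ x y : L, x ≠ y → ∃ a ∈ 𝒢, Xor (x ∈ a) (y ∈ a)

/-- The (zero-dimensional compact) space `L` is a Boolean image of the (compact) space `K`:
some family of clopen subsets of `L` that separates the points of `L` is isomorphic to a family
of pseudoclopens of `K`. -/
def IsBooleanImage (L K : Type*) [TopologicalSpace L] [TopologicalSpace K] : Prop :=
  ∃ 𝒢 : Set (Set L), (∀ a ∈ 𝒢, IsClopen a) ∧ SeparatesPointsOf 𝒢 ∧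
    ∃ φ : 𝒢 → Pseudoclopen K, IsPseudoclopenIso 𝒢 φ

/-! Suppose a separating clopen family `𝒢` on `L` is such that every proper nonempty clopen set is
crossed by an edge, a pair of points told apart by at most one member of `𝒢`. Points of `L` give
vertices of the cube `[0,1]^𝒢`, and the closed subspace `fuzzyCube 𝒢` cut out by the relations of
`𝒢` contains all vertices and the segments spanned by edges. A clopen subset of it cuts no such
segment, so by crossing it contains all vertices or none. Hence the vertices lie in one component,
and this component is the required connected space.

To find `𝒢`, send a locally constant `h : L → ZMod 2` to its jumps `h (f q) - h (f p)` over `p ⋖ q`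
in `M`. Only finitely many are nonzero, and only constants have none. The space of jump vectors is
determined by its coordinates in some set `T` of jumps and contains vectors dual to them; lift these
to functions `w t` and let `𝒢` consist of the sets `w t = 1`. Across a jump `t ∈ T` only `w t`
changes, so `t` gives an edge, and a nonconstant indicator function must jump at some `t ∈ T`. -/

open Set Function

/-! ### Linear algebra: dual coordinates -/

/-- A subspace `W` of `J →₀ F` has a basis dual to the coordinates in some `T ⊆ J`. -/
theorem Submodule.exists_dual_coordinates {F J : Type*} [Field F] (W : Submodule F (J →₀ F)) :
    ∃ T : Set J, (∀ v ∈ W, (∀ t ∈ T, v t = 0) → v = 0) ∧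
      ∀ t ∈ T, ∃ w ∈ W, w t = 1 ∧ ∀ s ∈ T, s ≠ t → w s = 0 := by
  classical
  have hπ : ∀ l : J →₀ F,
      Finsupp.linearCombination F (fun j : J => W.mkQ (Finsupp.single j 1)) l = W.mkQ l := by
    intro l
    conv_rhs => rw [← Finsupp.sum_single l]
    simp only [Finsupp.linearCombination_apply, Finsupp.sum, map_sum, ← map_smul,
      Finsupp.smul_single, smul_eq_mul, mul_one]
  -- `T` is the complement of a maximal `S` whose unit vectors are independent modulo `W`.
  -- Independence says that no nonzero vector of `W` is supported in `S`.
  obtain ⟨S, hS, hmax⟩ := exists_maximal_linearIndepOn F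
    (fun j : J => W.mkQ (Finsupp.single j 1))
  refine ⟨Sᶜ, fun v hv h0 => ?_, fun t ht => ?_⟩
  · refine linearIndepOn_iff.1 hS v ?_ ?_
    · rw [Finsupp.mem_supported']
      exact fun j hj => h0 j hj
    · rw [hπ]
      exact (Submodule.Quotient.mk_eq_zero W).2 hv
  -- By maximality some `a • e_t` with `a ≠ 0` agrees modulo `W` with a vector `l` supported in `S`;
  -- on `T`, the difference `l - a • e_t` lives at `t` only, with value `-a`.
  · obtain ⟨a, ha, hmem⟩ := hmax t ht
    obtain ⟨l, hl, hlt⟩ := (Finsupp.mem_span_image_iff_linearCombination F).1 hmem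
    rw [Finsupp.mem_supported'] at hl
    rw [hπ, ← map_smul, ← sub_eq_zero, ← map_sub] at hlt
    refine ⟨-a⁻¹ • (l - a • Finsupp.single t 1),
      W.smul_mem _ ((Submodule.Quotient.mk_eq_zero W).1 hlt), ?_, fun s hs hst => ?_⟩
    · simp [hl t ht, ha]
    · simp [hl s hs, hst.symm]

/-! ### Jumps in compact lines -/

/-- In a linear order, a locally constant function on a compact space jumps only finitely often. -/
theorem finite_covBy_ne {M Y : Type*} [LinearOrder M] [TopologicalSpace M] [OrderTopology M]
    [CompactSpace M] {h : M → Y} (hh : IsLocallyConstant h) :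
    {j : M × M | j.1 ⋖ j.2 ∧ h j.1 ≠ h j.2}.Finite := by
  have key : ∀ z : M, ∃ U : Set M, U ∈ nhds z ∧ U.OrdConnected ∧ ∀ x ∈ U, h x = h z := by
    intro z
    refine ⟨ordConnectedComponent {x | h x = h z} z, ?_, inferInstance,
      fun x hx => ordConnectedComponent_subset (s := {x | h x = h z}) hx⟩
    exact ordConnectedComponent_mem_nhds.2 ((hh.isOpen_fiber (h z)).mem_nhds rfl)
  choose U hU hc hh' using key
  obtain ⟨t, -, ht⟩ := isCompact_univ.elim_nhds_subcover U (fun z _ => hU z)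
  have hcov : ∀ x : M, ∃ z ∈ t, x ∈ U z := fun x => by simpa using ht (mem_univ x)
  choose c hct hcU using hcov
  refine Set.Finite.of_finite_image (f := fun j => c j.1)
    (t.finite_toSet.subset (by rintro _ ⟨j, -, rfl⟩; exact hct _)) ?_
  -- Two jumps assigned to the same convex piece start at the same point: otherwise the piece
  -- contains both ends of the lower jump, yet `h` is constant on it.
  have aux : ∀ p q p' q' : M, p ⋖ q → h p ≠ h q → c p = c p' → ¬ p < p' := by
    intro p q p' q' hpq hne hcc hlt
    have hq : q ∈ U (c p) := (hc _).out (hcU p) (hcc ▸ hcU p') ⟨hpq.le, hpq.ge_of_gt hlt⟩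
    exact hne ((hh' _ _ (hcU p)).trans (hh' _ _ hq).symm)
  rintro ⟨p, q⟩ ⟨h1, h2⟩ ⟨p', q'⟩ ⟨h1', h2'⟩ hcc
  have hp : p = p' := le_antisymm (not_lt.1 (aux p' q' p q h1' h2' hcc.symm))
    (not_lt.1 (aux p q p' q' h1 h2 hcc))
  subst hp
  exact Prod.ext rfl (h1.unique_right h1')

/-- Compactness provides the last point `p ≤ b` of `S` and then the first point `q ≥ p` outside `S`;
nothing fits between them. -/
theorem IsClopen.exists_covBy {M : Type*} [LinearOrder M] [TopologicalSpace M] [OrderTopology M]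
    [CompactSpace M] {S : Set M} (hS : IsClopen S) {a b : M} (ha : a ∈ S) (hb : b ∉ S)
    (hab : a < b) : ∃ p q, p ⋖ q ∧ p ∈ S ∧ q ∉ S := by
  obtain ⟨p, ⟨hpS, hpb⟩, hp⟩ := (hS.1.inter isClosed_Iic).isCompact.exists_isGreatest
    ⟨a, ha, (hab.le : a ∈ Iic b)⟩
  have hpb' : p < b := lt_of_le_of_ne hpb (by rintro rfl; exact hb hpS)
  obtain ⟨q, ⟨hqS, hpq⟩, hq⟩ := (hS.compl.1.inter isClosed_Ici).isCompact.exists_isLeast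
    ⟨b, hb, (hpb'.le : b ∈ Ici p)⟩
  have hpq' : p < q := lt_of_le_of_ne hpq (by rintro rfl; exact hqS hpS)
  have hqb : q ≤ b := hq ⟨hb, hpb'.le⟩
  refine ⟨p, q, ⟨hpq', fun z h1 h2 => ?_⟩, hpS, hqS⟩
  by_cases hz : z ∈ S
  · exact absurd (hp ⟨hz, h2.le.trans hqb⟩) h1.not_ge
  · exact absurd (hq ⟨hz, h1.le⟩) h2.not_ge

theorem IsLocallyConstant.eq_of_covBy {M Y : Type*} [LinearOrder M] [TopologicalSpace M]
    [OrderTopology M] [CompactSpace M] {h : M → Y} (hh : IsLocallyConstant h)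
    (hj : ∀ p q, p ⋖ q → h p = h q) (a b : M) : h a = h b := by
  have main : ∀ a b : M, a < b → h a = h b := by
    intro a b hab
    by_contra hne
    obtain ⟨p, q, hpq, hp, hq⟩ := (hh.isClopen_fiber (h a)).exists_covBy
      (a := a) (b := b) rfl (fun hb => hne (Eq.symm hb)) hab
    exact hq ((hj p q hpq).symm.trans hp)
  rcases lt_trichotomy a b with hab | rfl | hab
  exacts [main a b hab, rfl, (main b a hab).symm]

/-- The jumps of a locally constant function along a map from a compact line. -/
noncomputable def jumpMap {L M : Type*} [TopologicalSpace L] [LinearOrder M] [TopologicalSpace M]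
    [OrderTopology M] [CompactSpace M] {f : M → L} (hf : Continuous f) (F : Type*) [Field F] :
    LocallyConstant L F →ₗ[F] ({j : M × M // j.1 ⋖ j.2} →₀ F) where
  toFun h := Finsupp.ofSupportFinite (fun j => h (f j.1.2) - h (f j.1.1)) (by
    refine ((finite_covBy_ne (h.isLocallyConstant.comp_continuous hf)).preimage
      Subtype.val_injective.injOn).subset fun j hj => ⟨j.2, fun h0 => hj ?_⟩
    exact sub_eq_zero.2 h0.symm)
  map_add' g h := by
    ext j
    exact add_sub_add_comm _ _ _ _
  map_smul' c h := by
    ext j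
    exact (mul_sub _ _ _).symm

theorem jumpMap_apply {L M : Type*} [TopologicalSpace L] [LinearOrder M] [TopologicalSpace M]
    [OrderTopology M] [CompactSpace M] {f : M → L} (hf : Continuous f) (F : Type*) [Field F]
    (h : LocallyConstant L F) (j : {j : M × M // j.1 ⋖ j.2}) :
    jumpMap hf F h j = h (f j.1.2) - h (f j.1.1) := rfl

theorem eq_of_jumpMap_eq_zero {L M : Type*} [TopologicalSpace L] [LinearOrder M]
    [TopologicalSpace M] [OrderTopology M] [CompactSpace M] {f : M → L} (hf : Continuous f)
    (hs : Surjective f) (F : Type*) [Field F] (h : LocallyConstant L F)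
    (h0 : jumpMap hf F h = 0) (x y : L) : h x = h y := by
  obtain ⟨a, rfl⟩ := hs x
  obtain ⟨b, rfl⟩ := hs y
  refine IsLocallyConstant.eq_of_covBy (h.isLocallyConstant.comp_continuous hf) ?_ a b
  intro p q hpq
  have := DFunLike.congr_fun h0 ⟨(p, q), hpq⟩
  rw [jumpMap_apply] at this
  exact (sub_eq_zero.1 this).symm

/-! ### The clopen family and its edges -/

/-- Every proper nonempty clopen set is crossed by an edge: two points which at most one member
of `𝒢` distinguishes. -/
def CrossedByEdges {L : Type*} [TopologicalSpace L] (𝒢 : Set (Set L)) : Prop :=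
  ∀ U : Set L, IsClopen U → U.Nonempty → U ≠ univ → ∃ x ∈ U, ∃ y ∉ U, ∀ g ∈ 𝒢, ∀ g' ∈ 𝒢,
    ¬ (x ∈ g ↔ y ∈ g) → ¬ (x ∈ g' ↔ y ∈ g') → g = g'

theorem exists_separating_crossedByEdges {L M : Type*}
    [TopologicalSpace L] [T2Space L] (hL : ZeroDimensional L)
    [LinearOrder M] [TopologicalSpace M] [OrderTopology M] [CompactSpace M]
    {f : M → L} (hf : Continuous f) (hs : Surjective f) :
    ∃ 𝒢 : Set (Set L), (∀ a ∈ 𝒢, IsClopen a) ∧ SeparatesPointsOf 𝒢 ∧ CrossedByEdges 𝒢 := by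
  classical
  obtain ⟨T, hT, hw⟩ := Submodule.exists_dual_coordinates (LinearMap.range (jumpMap hf (ZMod 2)))
  have hw' : ∀ t : T, ∃ h : LocallyConstant L (ZMod 2), jumpMap hf (ZMod 2) h t = 1 ∧
      ∀ s : T, s ≠ t → jumpMap hf (ZMod 2) h s = 0 := by
    rintro ⟨t, ht⟩
    obtain ⟨_, ⟨h, rfl⟩, h1, h2⟩ := hw t ht
    exact ⟨h, h1, fun s hs => h2 s s.2 fun e => hs (Subtype.ext e)⟩
  choose w hw1 hw0 using hw'
  -- With two values, the set where a function equals 1 determines the function.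
  have hz : ∀ a b : ZMod 2, (a = 1 ↔ b = 1) → a = b := by clear * -; decide
  have sep : ∀ x y : L, (∀ t : T, w t x = w t y) → ∀ h : LocallyConstant L (ZMod 2),
      h x = h y := by
    intro x y hxy h
    -- Up to a constant, `h` is the finite combination `r` of the `w t` whose coefficients are its
    -- own jumps in `T`.
    set S : Finset T := (jumpMap hf (ZMod 2) h).support.subtype (· ∈ T) with hS
    set r : LocallyConstant L (ZMod 2) := ∑ t ∈ S, jumpMap hf (ZMod 2) h t • w t with hr
    have h0 : jumpMap hf (ZMod 2) (h - r) = 0 := by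
      refine hT _ ⟨_, rfl⟩ fun t ht => ?_
      rw [map_sub, hr, map_sum, Finsupp.sub_apply, Finsupp.finsetSum_apply,
        Finset.sum_eq_single ⟨t, ht⟩]
      · simp [hw1]
      · intro s _ hst
        simp [hw0 s ⟨t, ht⟩ hst.symm]
      · intro hts
        have h3 : jumpMap hf (ZMod 2) h t = 0 := by simpa [hS] using hts
        simp [h3]
    have h1 := eq_of_jumpMap_eq_zero hf hs (ZMod 2) _ h0 x y
    have h2 : r x = r y := by
      have hev : ∀ z, r z = ∑ t ∈ S, jumpMap hf (ZMod 2) h t * w t z := fun z =>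
        map_sum (LocallyConstant.evalAddMonoidHom z) _ S
      simp only [hev, hxy]
    rwa [LocallyConstant.sub_apply, LocallyConstant.sub_apply, h2, sub_left_inj] at h1
  have memw : ∀ (t : T) (x y : L), (x ∈ w t ⁻¹' {1} ↔ y ∈ w t ⁻¹' {1}) ↔ w t x = w t y :=
    fun t x y => ⟨fun e => hz _ _ e, fun e => by simp [e]⟩
  refine ⟨range fun t : T => w t ⁻¹' {1}, ?_, ?_, ?_⟩
  · rintro _ ⟨t, rfl⟩
    exact (w t).isLocallyConstant.isClopen_fiber 1
  · intro x y hxy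
    by_contra hcon
    obtain ⟨U, hU, hxU, hUy⟩ := hL.exists_subset_of_mem_open (a := x) (u := {y}ᶜ) hxy
      isOpen_compl_singleton
    have := sep x y (fun t => (memw t x y).1 ?_) (LocallyConstant.charFn (ZMod 2) hU)
    · have hyU : y ∉ U := fun h => hUy h rfl
      simp [LocallyConstant.coe_charFn, hxU, hyU] at this
    · by_contra hne
      exact hcon ⟨_, ⟨t, rfl⟩, (xor_iff_not_iff _ _).2 hne⟩
  · intro U hU hne huniv
    have hv : ∃ t : T, jumpMap hf (ZMod 2) (LocallyConstant.charFn (ZMod 2) hU) t ≠ 0 := by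
      by_contra! hcon
      have h0 := hT _ ⟨_, rfl⟩ fun t ht => hcon ⟨t, ht⟩
      obtain ⟨x, hx⟩ := hne
      obtain ⟨y, hy⟩ := (ne_univ_iff_exists_notMem U).1 huniv
      have := eq_of_jumpMap_eq_zero hf hs (ZMod 2) _ h0 x y
      simp [LocallyConstant.coe_charFn, hx, hy] at this
    obtain ⟨⟨⟨⟨p, q⟩, hpq⟩, ht⟩, hne'⟩ := hv
    rw [jumpMap_apply, LocallyConstant.coe_charFn] at hne'
    have key : ∀ s : T, w s (f p) ≠ w s (f q) → s = ⟨⟨(p, q), hpq⟩, ht⟩ := by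
      intro s hs'
      by_contra hst
      exact hs' (sub_eq_zero.1 (hw0 s _ (Ne.symm hst))).symm
    by_cases hp : f p ∈ U <;> by_cases hq : f q ∈ U
    · simp [hp, hq] at hne'
    · refine ⟨f p, hp, f q, hq, ?_⟩
      rintro _ ⟨s, rfl⟩ _ ⟨s', rfl⟩ h1 h2
      rw [memw] at h1 h2
      rw [key s h1, key s' h2]
    · refine ⟨f q, hq, f p, hp, ?_⟩
      rintro _ ⟨s, rfl⟩ _ ⟨s', rfl⟩ h1 h2
      rw [memw] at h1 h2
      rw [key s (Ne.symm h1), key s' (Ne.symm h2)]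
    · simp [hp, hq] at hne'

/-! ### The fuzzy cube and its connected component -/

/-- The largest subspace of the cube `[0,1]^𝒢` on which `g ↦ ({x | 2/3 ≤ x g}, {x | 1/3 < x g})`
respects the relations of `𝒢`. -/
def fuzzyCube {L : Type*} (𝒢 : Set (Set L)) : Set (𝒢 → unitInterval) :=
  {x | ∀ A B : Finset 𝒢, Disjoint A B → (⋂ a ∈ A, (a : Set L)) \ (⋃ b ∈ B, (b : Set L)) = ∅ →
    ¬ ((∀ a ∈ A, (1 / 3 : ℝ) < x a) ∧ ∀ b ∈ B, (x b : ℝ) < 2 / 3)}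

theorem isClosed_fuzzyCube {L : Type*} (𝒢 : Set (Set L)) : IsClosed (fuzzyCube 𝒢) := by
  simp only [fuzzyCube, ofPred_forall]
  refine isClosed_iInter fun A => isClosed_iInter fun B => isClosed_iInter fun _ =>
    isClosed_iInter fun _ => ?_
  rw [← isOpen_compl_iff]
  have : {x : 𝒢 → unitInterval | ¬ ((∀ a ∈ A, (1 / 3 : ℝ) < x a) ∧ ∀ b ∈ B, (x b : ℝ) < 2 / 3)}ᶜ
      = (⋂ a ∈ A, {x | (1 / 3 : ℝ) < x a}) ∩ ⋂ b ∈ B, {x | (x b : ℝ) < 2 / 3} := by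
    ext x; simp
  rw [this]
  exact (isOpen_biInter_finset fun a _ => isOpen_lt (by fun_prop) (by fun_prop)).inter
    (isOpen_biInter_finset fun b _ => isOpen_lt (by fun_prop) (by fun_prop))

open Classical in
/-- The vertex of the cube `[0,1]^𝒢` given by the members of `𝒢` which contain a point. -/
noncomputable def cubeVertex {L : Type*} (𝒢 : Set (Set L)) (x : L) : 𝒢 → unitInterval :=
  fun g => if x ∈ (g : Set L) then 1 else 0

theorem cubeVertex_of_mem {L : Type*} {𝒢 : Set (Set L)} {x : L} {g : 𝒢} (h : x ∈ (g : Set L)) :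
    cubeVertex 𝒢 x g = 1 := if_pos h

theorem cubeVertex_of_notMem {L : Type*} {𝒢 : Set (Set L)} {x : L} {g : 𝒢}
    (h : x ∉ (g : Set L)) : cubeVertex 𝒢 x g = 0 := if_neg h

theorem continuous_cubeVertex {L : Type*} [TopologicalSpace L] {𝒢 : Set (Set L)}
    (h𝒢 : ∀ a ∈ 𝒢, IsClopen a) : Continuous (cubeVertex 𝒢) :=
  continuous_pi fun g => by
    classical
    exact continuous_const.if (fun a ha => by simp [(h𝒢 g g.2).frontier_eq] at ha) continuous_const

open Classical in
/-- If at most the member `g` of `𝒢` distinguishes `x` and `y`, the edge between the vertices of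
`x` and `y` lies in the fuzzy cube. -/
theorem update_cubeVertex_mem {L : Type*} {𝒢 : Set (Set L)} {x y : L} {g : 𝒢}
    (hx : x ∈ (g : Set L)) (hy : y ∉ (g : Set L))
    (h : ∀ g' : 𝒢, g' ≠ g → (x ∈ (g' : Set L) ↔ y ∈ (g' : Set L))) (s : unitInterval) :
    update (cubeVertex 𝒢 x) g s ∈ fuzzyCube 𝒢 := by
  rintro A B hAB h0 ⟨hA, hB⟩
  have memA : ∀ a ∈ A, a ≠ g → x ∈ (a : Set L) := by
    intro a ha hag
    by_contra hxa
    have := hA a ha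
    rw [update_of_ne hag, cubeVertex_of_notMem hxa] at this
    norm_num at this
  have memB : ∀ b ∈ B, b ≠ g → x ∉ (b : Set L) := by
    intro b hb hbg hxb
    have := hB b hb
    rw [update_of_ne hbg, cubeVertex_of_mem hxb] at this
    norm_num at this
  -- A point of the edge violating a relation would make an endpoint violate it: `y`, which avoids
  -- `g`, if `g ∈ B`, and `x` otherwise.
  by_cases hgB : g ∈ B
  · have hgA : g ∉ A := fun hgA => Finset.disjoint_left.1 hAB hgA hgB
    refine eq_empty_iff_forall_notMem.1 h0 y ⟨?_, ?_⟩
    · simp only [mem_iInter]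
      intro a ha
      have hag : a ≠ g := by rintro rfl; exact hgA ha
      exact (h a hag).1 (memA a ha hag)
    · simp only [mem_iUnion, not_exists]
      intro b hb
      by_cases hbg : b = g
      · rwa [hbg]
      · exact fun hyb => memB b hb hbg ((h b hbg).2 hyb)
  · refine eq_empty_iff_forall_notMem.1 h0 x ⟨?_, ?_⟩
    · simp only [mem_iInter]
      intro a ha
      by_cases hag : a = g
      · rwa [hag]
      · exact memA a ha hag
    · simp only [mem_iUnion, not_exists]
      intro b hb
      exact memB b hb (by rintro rfl; exact hgB hb)

theorem cubeVertex_mem {L : Type*} (𝒢 : Set (Set L)) (x : L) : cubeVertex 𝒢 x ∈ fuzzyCube 𝒢 := by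
  rintro A B hAB h0 ⟨hA, hB⟩
  refine eq_empty_iff_forall_notMem.1 h0 x ⟨?_, ?_⟩
  · simp only [mem_iInter]
    intro a ha
    by_contra hxa
    have := hA a ha
    rw [cubeVertex_of_notMem hxa] at this
    norm_num at this
  · simp only [mem_iUnion, not_exists]
    intro b hb hxb
    have := hB b hb
    rw [cubeVertex_of_mem hxb] at this
    norm_num at this

/-- An edge of the fuzzy cube does not cross a clopen set. -/
theorem cubeVertex_mem_clopen {L : Type*} {𝒢 : Set (Set L)} {Z : Set (fuzzyCube 𝒢)}
    (hZ : IsClopen Z) {x y : L} {g : 𝒢} (hx : x ∈ (g : Set L)) (hy : y ∉ (g : Set L))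
    (h : ∀ g' : 𝒢, g' ≠ g → (x ∈ (g' : Set L) ↔ y ∈ (g' : Set L))) :
    (⟨_, cubeVertex_mem 𝒢 x⟩ : fuzzyCube 𝒢) ∈ Z ↔ (⟨_, cubeVertex_mem 𝒢 y⟩ : fuzzyCube 𝒢) ∈ Z := by
  classical
  set γ : unitInterval → fuzzyCube 𝒢 :=
    fun s => ⟨update (cubeVertex 𝒢 x) g s, update_cubeVertex_mem hx hy h s⟩ with hγ
  have hc : Continuous γ := by
    refine Continuous.subtype_mk ?_ _
    exact continuous_const.update g continuous_id
  have hγx : γ 1 = ⟨_, cubeVertex_mem 𝒢 x⟩ := by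
    refine Subtype.ext ?_
    simp only [hγ]
    rw [← cubeVertex_of_mem hx, update_eq_self]
  have hγy : γ 0 = ⟨_, cubeVertex_mem 𝒢 y⟩ := by
    refine Subtype.ext (funext fun g' => ?_)
    simp only [hγ]
    by_cases hg : g' = g
    · subst hg; rw [update_self, cubeVertex_of_notMem hy]
    · rw [update_of_ne hg]
      by_cases hxg : x ∈ (g' : Set L)
      · rw [cubeVertex_of_mem hxg, cubeVertex_of_mem ((h g' hg).1 hxg)]
      · rw [cubeVertex_of_notMem hxg, cubeVertex_of_notMem fun hh => hxg ((h g' hg).2 hh)]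
  rw [← hγx, ← hγy]
  rcases isClopen_iff.1 (hZ.preimage hc) with h0 | h0
  · exact iff_of_false (fun hh => h0.le hh) (fun hh => h0.le hh)
  · exact iff_of_true (h0.ge (mem_univ 1)) (h0.ge (mem_univ 0))

/-- All vertices lie in one component of the fuzzy cube. -/
theorem cubeVertex_mem_connectedComponent {L : Type*} [TopologicalSpace L] {𝒢 : Set (Set L)}
    (h𝒢 : ∀ a ∈ 𝒢, IsClopen a) (hsep : SeparatesPointsOf 𝒢) (hedge : CrossedByEdges 𝒢) (x y : L) :
    (⟨_, cubeVertex_mem 𝒢 y⟩ : fuzzyCube 𝒢) ∈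
      connectedComponent (⟨_, cubeVertex_mem 𝒢 x⟩ : fuzzyCube 𝒢) := by
  have : CompactSpace (fuzzyCube 𝒢) := isCompact_iff_compactSpace.1 (isClosed_fuzzyCube 𝒢).isCompact
  -- In a compact Hausdorff space components are intersections of clopen sets, so it suffices that
  -- no clopen `Z` separates two vertices.
  rw [connectedComponent_eq_iInter_isClopen, mem_iInter]
  rintro ⟨Z, hZ, hxZ⟩
  set e : L → fuzzyCube 𝒢 := fun z => ⟨_, cubeVertex_mem 𝒢 z⟩
  have he : Continuous e := (continuous_cubeVertex h𝒢).subtype_mk _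
  by_contra hyZ
  obtain ⟨p, hp, q, hq, hpq⟩ := hedge (e ⁻¹' Z) (hZ.preimage he) ⟨x, hxZ⟩
    fun h => hyZ (h.ge (mem_univ y))
  obtain ⟨g, hg, hx⟩ := hsep p q (by rintro rfl; exact hq hp)
  have huniq : ∀ g' : 𝒢, g' ≠ ⟨g, hg⟩ → (p ∈ (g' : Set L) ↔ q ∈ (g' : Set L)) := by
    intro g' hne
    by_contra hcon
    exact hne (Subtype.ext (hpq g' g'.2 g hg hcon ((xor_iff_not_iff _ _).1 hx)))
  rcases hx with ⟨h1, h2⟩ | ⟨h1, h2⟩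
  · exact hq ((cubeVertex_mem_clopen hZ (g := ⟨g, hg⟩) h1 h2 huniq).1 hp)
  · exact hq ((cubeVertex_mem_clopen hZ (g := ⟨g, hg⟩) h1 h2 fun g' hne =>
      (huniq g' hne).symm).2 hp)

/-- A subspace of the fuzzy cube which contains all vertices has `L` as a Boolean image. -/
theorem isBooleanImage_of_cubeVertex_mem {L : Type*} [TopologicalSpace L] {𝒢 : Set (Set L)}
    (h𝒢 : ∀ a ∈ 𝒢, IsClopen a) (hsep : SeparatesPointsOf 𝒢) (C : Set (fuzzyCube 𝒢))
    (hC : ∀ x, (⟨_, cubeVertex_mem 𝒢 x⟩ : fuzzyCube 𝒢) ∈ C) : IsBooleanImage L C := by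
  have hc : ∀ g : 𝒢, Continuous fun x : C => (x.1.1 g : ℝ) := fun g =>
    continuous_subtype_val.comp ((continuous_apply g).comp
      (continuous_subtype_val.comp continuous_subtype_val))
  refine ⟨𝒢, h𝒢, hsep, fun g => ⟨{x : C | (2 / 3 : ℝ) ≤ x.1.1 g}, {x : C | (1 / 3 : ℝ) < x.1.1 g},
    isClosed_le continuous_const (hc g), isOpen_lt continuous_const (hc g), fun x hx => ?_⟩, ?_⟩
  · exact lt_of_lt_of_le (by norm_num) (show (2 / 3 : ℝ) ≤ x.1.1 g from hx)
  · intro A B hAB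
    refine ⟨fun h0 => ?_, fun h0 => ?_⟩
    · rw [eq_empty_iff_forall_notMem]
      rintro x ⟨h1, h2⟩
      simp only [mem_iInter, mem_iUnion, not_exists, mem_ofPred_eq, not_le] at h1 h2
      -- The first implication is the definition of the fuzzy cube; the second is witnessed by
      -- vertices, whose coordinates are 0 and 1.
      exact x.1.2 A B hAB h0 ⟨h1, h2⟩
    · rw [eq_empty_iff_forall_notMem] at h0 ⊢
      rintro x ⟨h1, h2⟩
      simp only [mem_iInter, mem_iUnion, not_exists] at h1 h2
      refine h0 ⟨_, hC x⟩ ⟨?_, ?_⟩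
      · simp only [mem_iInter, mem_ofPred_eq]
        intro a ha
        rw [cubeVertex_of_mem (h1 a ha)]
        norm_num
      · simp only [mem_iUnion, not_exists, mem_ofPred_eq]
        intro b hb
        rw [cubeVertex_of_notMem (h2 b hb)]
        norm_num

theorem corollary3p5 {L : Type u} {M : Type v}
    [TopologicalSpace L] [CompactSpace L] [T2Space L] [Nonempty L]
    (hL : ZeroDimensional L)
    [LinearOrder M] [TopologicalSpace M] [OrderTopology M] [CompactSpace M]
    (hM : ZeroDimensional M)
    (f : M → L) (hf : Continuous f) (hf_surj : Function.Surjective f) :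
    ∃ (K : Type u) (_ : TopologicalSpace K),
      CompactSpace K ∧ T2Space K ∧ ConnectedSpace K ∧ IsBooleanImage L K := by
  obtain ⟨𝒢, h𝒢, hsep, hedge⟩ := exists_separating_crossedByEdges hL hf hf_surj
  obtain ⟨x⟩ := ‹Nonempty L›
  have : CompactSpace (fuzzyCube 𝒢) := isCompact_iff_compactSpace.1 (isClosed_fuzzyCube 𝒢).isCompact
  refine ⟨connectedComponent (⟨_, cubeVertex_mem 𝒢 x⟩ : fuzzyCube 𝒢), inferInstance,
    isCompact_iff_compactSpace.1 isClosed_connectedComponent.isCompact, inferInstance,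
    isConnected_iff_connectedSpace.1 isConnected_connectedComponent, ?_⟩
  exact isBooleanImage_of_cubeVertex_mem h𝒢 hsep _
    (cubeVertex_mem_connectedComponent h𝒢 hsep hedge x)
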